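/- All Hilbert spaces are complex. A bounded operator $U$ on a separable infinite-dimensional Hilbert space $E$ is called \emph{universal} if for every bounded operator $T$ on $E$ there are a closed subspace $M\subset E$ with $U(M)\subset M$, a constant $c\neq 0$ and a linear homeomorphism $J:M\to E$ such that $J\,U_{|M}=cT\,J$. A pair $(U_1,U_2)$ of commuting bounded operators on $E$ is called a \emph{universal commuting pair} if for every pair $(S_1,S_2)$ of commuting bounded operators on $E$ there are a constant $c\neq 0$, a closed subspace $M\subset E$ invariant under both $U_1$ and $U_2$, and a linear homeomorphism $V:E\to M$ such that $U_1V=cVS_1$ and $U_2V=cVS_2$. For a Hilbert space $K$ let $\mathcal C_2(K)$ be the Hilbert space of Hilbert--Schmidt operators on $K$ with the norm $\|S\|_2=\big(\sum_i\|Sf_i\|^2\big)^{1/2}$, where $(f_i)$ is any orthonormal basis of $K$, and for a bounded operator $U$ on $K$ let $L_U$ and $R_U$ be the bounded operators $L_U(S)=US$ and $R_U(S)=SU$ on $\mathcal C_2(K)$. Let $B$ be the backward shift $(x_0,x_1,\ldots)\mapsto(x_1,x_2,\ldots)$ on $\ell^2=\ell^2(\mathbb Z_+)$. Let $H$ be a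 separable infinite-dimensional Hilbert space, $\mathcal H=\ell^2(\mathbb Z_+,H)$, and let $B_\infty$ be the backward shift $(x_0,x_1,\ldots)\mapsto(x_1,x_2,\ldots)$ on $\mathcal H$. \textbf{Theorem.} (i) The operators $L_B$ and $R_{B^*}$ are universal on $\mathcal C_2(\ell^2)$, and the operators $L_{B_\infty}$ and $R_{B_\infty^*}$ are universal on $\mathcal C_2(\mathcal H)$. (ii) $L_B$ and $R_{B^*}$ commute, $\operatorname{Ker}(L_B)\cap\operatorname{Ker}(R_{B^*})$ is one-dimensional, and $(L_B,R_{B^*})$ is not a universal commuting pair on $\mathcal C_2(\ell^2)$. (iii) $(L_{B_\infty},R_{B_\infty^*})$ is a universal commuting pair on $\mathcal C_2(\mathcal H)$. Moreover, $L_{B_\infty}$ and $R_{B_\infty^*}$ are surjective, $\operatorname{Ker}(L_{B_\infty})\cap\operatorname{Ker}(R_{B_\infty^*})$ is infinite-dimensional, and $\operatorname{Ker}(L_{B_\infty}R_{B_\infty^*})=\operatorname{Ker}(L_{B_\infty})+\operatorname{Ker}(R_{B_\infty^*})$. -/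

import Mathlib

open scoped ENNReal NNReal lp

noncomputable section

/-! ### Universal operators and universal commuting pairs -/

/-- `U` is universal: for every bounded operator `T` on the same space there are a closed
`U`-invariant subspace `M` and a constant `c ≠ 0` such that the restriction `U|_M : M → M` and
`c T` are similar, i.e. `J ∘ U|_M = c T ∘ J` for a linear homeomorphism `J : M → E`. -/
def IsUniversalOperator {E : Type*} [NormedAddCommGroup E] [NormedSpace ℂ E]
    (U : E →L[ℂ] E) : Prop :=
  ∀ T : E →L[ℂ] E, ∃ (M : Submodule ℂ E) (hM : ∀ x ∈ M, U x ∈ M) (c : ℂ) (J : M ≃L[ℂ] E),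
    IsClosed (M : Set E) ∧ c ≠ 0 ∧ ∀ x : M, J ⟨U x, hM x x.2⟩ = c • T (J x)

/-- `(U₁, U₂)` is a universal commuting pair: `U₁` and `U₂` commute, and for every commuting pair
`(S₁, S₂)` on the same space there are a constant `c ≠ 0`, a closed subspace `M` invariant under
both `U₁` and `U₂`, and a linear homeomorphism `V : E → M` with `U₁ V = c V S₁` and
`U₂ V = c V S₂`. -/
def IsUniversalCommutingPair {E : Type*} [NormedAddCommGroup E] [NormedSpace ℂ E]
    (U₁ U₂ : E →L[ℂ] E) : Prop :=
  Commute U₁ U₂ ∧ ∀ S₁ S₂ : E →L[ℂ] E, Commute S₁ S₂ →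
    ∃ (c : ℂ) (M : Submodule ℂ E) (V : E ≃L[ℂ] M),
      c ≠ 0 ∧ IsClosed (M : Set E) ∧ (∀ x ∈ M, U₁ x ∈ M) ∧ (∀ x ∈ M, U₂ x ∈ M) ∧
      (∀ x : E, U₁ (V x : E) = c • (V (S₁ x) : E)) ∧
      (∀ x : E, U₂ (V x : E) = c • (V (S₂ x) : E))

/-! ### Hilbert-Schmidt operators -/

/-- `T` is Hilbert-Schmidt: `∑ ‖T f‖² < ∞` over some orthonormal basis. -/
def IsHilbertSchmidt {H : Type*} [NormedAddCommGroup H] [InnerProductSpace ℂ H]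
    (T : H →L[ℂ] H) : Prop :=
  ∃ (w : Set H) (b : HilbertBasis w ℂ H), Summable fun i => ‖T (b i)‖ ^ 2

section HSAux

variable {H : Type*} [NormedAddCommGroup H] [InnerProductSpace ℂ H]

theorem hilbertBasis_tsum_enorm_inner_sq {ι : Type*} (b : HilbertBasis ι ℂ H) (x : H) :
    ∑' i, ‖inner ℂ (b i) x‖ₑ ^ 2 = ‖x‖ₑ ^ 2 := by
  have h := lp.hasSum_norm (p := 2) (by norm_num) (b.repr x)
  simp only [b.repr_apply_apply, LinearIsometryEquiv.norm_map, ENNReal.toReal_ofNat,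
    Real.rpow_ofNat] at h
  have h2 := ENNReal.ofReal_tsum_of_nonneg (fun i => by positivity) h.summable
  rw [h.tsum_eq] at h2
  simpa [ENNReal.ofReal_pow, ofReal_norm] using h2.symm

/-- `∑ ‖T bᵢ‖² = ∑ ‖T* cⱼ‖²` for any two orthonormal bases. -/
theorem tsum_enorm_sq_adjoint [CompleteSpace H] {ι κ : Type*} (b : HilbertBasis ι ℂ H)
    (c : HilbertBasis κ ℂ H) (T : H →L[ℂ] H) :
    ∑' i, ‖T (b i)‖ₑ ^ 2 = ∑' j, ‖ContinuousLinearMap.adjoint T (c j)‖ₑ ^ 2 := by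
  have h1 : ∀ i, ‖T (b i)‖ₑ ^ 2 = ∑' j, ‖inner ℂ (c j) (T (b i))‖ₑ ^ 2 := fun i =>
    (hilbertBasis_tsum_enorm_inner_sq c _).symm
  have h2 : ∀ j, ‖ContinuousLinearMap.adjoint T (c j)‖ₑ ^ 2
      = ∑' i, ‖inner ℂ (c j) (T (b i))‖ₑ ^ 2 := fun j => by
    rw [← hilbertBasis_tsum_enorm_inner_sq b]
    refine tsum_congr fun i => ?_
    rw [ContinuousLinearMap.adjoint_inner_right, ← ofReal_norm, ← ofReal_norm, norm_inner_symm]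
  simp_rw [h1, h2]
  exact ENNReal.tsum_comm

/-- Independence of the basis. -/
theorem tsum_enorm_sq_basis [CompleteSpace H] {ι κ : Type*} (b : HilbertBasis ι ℂ H)
    (c : HilbertBasis κ ℂ H) (T : H →L[ℂ] H) :
    ∑' i, ‖T (b i)‖ₑ ^ 2 = ∑' j, ‖T (c j)‖ₑ ^ 2 := by
  rw [tsum_enorm_sq_adjoint b c T, tsum_enorm_sq_adjoint c c T]

theorem summable_norm_sq_iff {E ι : Type*} [NormedAddCommGroup E] (f : ι → E) :
    (Summable fun i => ‖f i‖ ^ 2) ↔ ∑' i, ‖f i‖ₑ ^ 2 ≠ ∞ := by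
  have h : ∀ i, ‖f i‖ₑ ^ 2 = ((‖f i‖₊ ^ 2 : ℝ≥0) : ℝ≥0∞) := fun i => by
    simp [enorm_eq_nnnorm]
  simp_rw [h]
  rw [ENNReal.tsum_coe_ne_top_iff_summable, ← NNReal.summable_coe]
  simp

theorem isHilbertSchmidt_iff [CompleteSpace H] {ι : Type*} (b : HilbertBasis ι ℂ H)
    (T : H →L[ℂ] H) : IsHilbertSchmidt T ↔ Summable fun i => ‖T (b i)‖ ^ 2 := by
  constructor
  · rintro ⟨w, c, hc⟩
    rw [summable_norm_sq_iff] at hc ⊢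
    rwa [tsum_enorm_sq_basis b c]
  · intro h
    obtain ⟨w, c, -⟩ := exists_hilbertBasis ℂ H
    refine ⟨w, c, ?_⟩
    rw [summable_norm_sq_iff] at h ⊢
    rwa [tsum_enorm_sq_basis c b]

theorem isHilbertSchmidt_iff_memℓp [CompleteSpace H] {ι : Type*} (b : HilbertBasis ι ℂ H)
    (T : H →L[ℂ] H) : IsHilbertSchmidt T ↔ Memℓp (fun i => T (b i)) 2 := by
  rw [isHilbertSchmidt_iff b, memℓp_gen_iff (by norm_num)]
  simp

theorem hilbertBasis_ext {ι : Type*} (b : HilbertBasis ι ℂ H) {S T : H →L[ℂ] H}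
    (h : ∀ i, S (b i) = T (b i)) : S = T := by
  refine ContinuousLinearMap.ext_on (s := Set.range b) ?_ ?_
  · have := b.dense_span
    exact Submodule.dense_iff_topologicalClosure_eq_top.mpr this
  · rintro _ ⟨i, rfl⟩
    exact h i

theorem IsHilbertSchmidt.comp_left [CompleteSpace H] {S : H →L[ℂ] H} (hS : IsHilbertSchmidt S)
    (U : H →L[ℂ] H) : IsHilbertSchmidt (U ∘L S) := by
  obtain ⟨w, b, hb⟩ := hS
  refine ⟨w, b, Summable.of_nonneg_of_le (fun i => by positivity) (fun i => ?_)
    (hb.mul_left (‖U‖ ^ 2))⟩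
  rw [← mul_pow]
  exact pow_le_pow_left₀ (norm_nonneg _) (U.le_opNorm _) 2

theorem IsHilbertSchmidt.adjoint [CompleteSpace H] {S : H →L[ℂ] H} (hS : IsHilbertSchmidt S) :
    IsHilbertSchmidt (ContinuousLinearMap.adjoint S) := by
  obtain ⟨w, b, hb⟩ := hS
  refine ⟨w, b, ?_⟩
  rw [summable_norm_sq_iff] at hb ⊢
  rwa [← tsum_enorm_sq_adjoint b b]

theorem IsHilbertSchmidt.comp_right [CompleteSpace H] {S : H →L[ℂ] H} (hS : IsHilbertSchmidt S)
    (V : H →L[ℂ] H) : IsHilbertSchmidt (S ∘L V) := by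
  have h := (hS.adjoint.comp_left (ContinuousLinearMap.adjoint V)).adjoint
  rwa [ContinuousLinearMap.adjoint_comp, ContinuousLinearMap.adjoint_adjoint,
    ContinuousLinearMap.adjoint_adjoint] at h

end HSAux

/-- The linear space of Hilbert-Schmidt operators inside all bounded operators. -/
def hilbertSchmidtSubmodule (H : Type*) [NormedAddCommGroup H] [InnerProductSpace ℂ H]
    [CompleteSpace H] : Submodule ℂ (H →L[ℂ] H) where
  carrier := {T | IsHilbertSchmidt T}
  zero_mem' := by
    obtain ⟨w, b, -⟩ := exists_hilbertBasis ℂ H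
    exact ⟨w, b, by simp⟩
  add_mem' := by
    intro S T hS hT
    obtain ⟨w, b, -⟩ := exists_hilbertBasis ℂ H
    exact (isHilbertSchmidt_iff_memℓp b _).2
      (((isHilbertSchmidt_iff_memℓp b S).1 hS).add ((isHilbertSchmidt_iff_memℓp b T).1 hT))
  smul_mem' := by
    intro c T hT
    obtain ⟨w, b, -⟩ := exists_hilbertBasis ℂ H
    exact (isHilbertSchmidt_iff_memℓp b _).2
      (((isHilbertSchmidt_iff_memℓp b T).1 hT).const_smul c)

/-- The Hilbert-Schmidt class `C₂(H)`. This is a type of its own, so that it carries the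
Hilbert-Schmidt norm defined below and not the operator norm. -/
def HilbertSchmidt (H : Type*) [NormedAddCommGroup H] [InnerProductSpace ℂ H]
    [CompleteSpace H] : Type _ :=
  ↥(hilbertSchmidtSubmodule H)

namespace HilbertSchmidt

variable {H : Type*} [NormedAddCommGroup H] [InnerProductSpace ℂ H] [CompleteSpace H]

instance instAddCommGroup : AddCommGroup (HilbertSchmidt H) :=
  inferInstanceAs (AddCommGroup ↥(hilbertSchmidtSubmodule H))

instance instModule : Module ℂ (HilbertSchmidt H) :=
  inferInstanceAs (Module ℂ ↥(hilbertSchmidtSubmodule H))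

variable (H) in
/-- The inclusion of `C₂(H)` into the bounded operators. -/
def toCLM : HilbertSchmidt H →ₗ[ℂ] (H →L[ℂ] H) := (hilbertSchmidtSubmodule H).subtype

/-- A bounded operator that is Hilbert-Schmidt, as an element of `C₂(H)`. -/
def mk (T : H →L[ℂ] H) (hT : IsHilbertSchmidt T) : HilbertSchmidt H := ⟨T, hT⟩

theorem isHilbertSchmidt (S : HilbertSchmidt H) : IsHilbertSchmidt (toCLM H S) := S.2

@[simp] theorem toCLM_mk (T : H →L[ℂ] H) (hT : IsHilbertSchmidt T) : toCLM H (mk T hT) = T := rfl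

theorem toCLM_injective : Function.Injective (toCLM H) := Subtype.val_injective

/-- For an orthonormal basis `b`, the map `S ↦ (S bᵢ)ᵢ` from `C₂(H)` to `ℓ²(ι, H)`. -/
def column {ι : Type*} (b : HilbertBasis ι ℂ H) : HilbertSchmidt H →ₗ[ℂ] ℓ²(ι, H) where
  toFun S := ⟨fun i => toCLM H S (b i), (isHilbertSchmidt_iff_memℓp b _).1 S.isHilbertSchmidt⟩
  map_add' S T := by
    ext i
    rfl
  map_smul' c S := by
    ext i
    rfl

@[simp] theorem column_apply {ι : Type*} (b : HilbertBasis ι ℂ H) (S : HilbertSchmidt H) (i : ι) :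
    column b S i = toCLM H S (b i) := rfl

theorem column_injective {ι : Type*} (b : HilbertBasis ι ℂ H) :
    Function.Injective (column b) := fun _ _ h =>
  toCLM_injective (hilbertBasis_ext b fun i => congrFun (congrArg (fun f : ℓ²(ι, H) => ⇑f) h) i)

variable (H) in
/-- An orthonormal basis of `H`, fixed to write down the Hilbert-Schmidt norm; the norm does not
depend on it, see `HilbertSchmidt.norm_sq_eq_tsum`. -/
def stdBasis : HilbertBasis (exists_hilbertBasis ℂ H).choose ℂ H :=
  (exists_hilbertBasis ℂ H).choose_spec.choose

/-- The norm `‖S‖₂ = (∑ ‖S fᵢ‖²)^(1/2)`. -/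
instance instNormedAddCommGroup : NormedAddCommGroup (HilbertSchmidt H) :=
  NormedAddCommGroup.induced (HilbertSchmidt H) _ (column (stdBasis H))
    (column_injective (stdBasis H))

theorem norm_def (S : HilbertSchmidt H) : ‖S‖ = ‖column (stdBasis H) S‖ := rfl

/-- The inner product `⟪S, T⟫ = ∑ ⟪S fᵢ, T fᵢ⟫`. -/
instance instInnerProductSpace : InnerProductSpace ℂ (HilbertSchmidt H) where
  norm_smul_le c S := by
    rw [norm_def, norm_def, map_smul, norm_smul]
  inner S T := inner ℂ (column (stdBasis H) S) (column (stdBasis H) T)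
  norm_sq_eq_re_inner S := by
    rw [norm_def]
    exact norm_sq_eq_re_inner _
  conj_inner_symm S T := inner_conj_symm _ _
  add_left S T R := by
    simp only [map_add, inner_add_left]
  smul_left S T c := by
    simp only [map_smul, inner_smul_left]

theorem enorm_sq_eq_tsum {ι : Type*} (b : HilbertBasis ι ℂ H) (S : HilbertSchmidt H) :
    ‖S‖ₑ ^ 2 = ∑' i, ‖toCLM H S (b i)‖ₑ ^ 2 := by
  rw [tsum_enorm_sq_basis b (stdBasis H)]
  have h := lp.hasSum_norm (p := 2) (by norm_num) (column (stdBasis H) S)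
  simp only [← norm_def, column_apply, ENNReal.toReal_ofNat, Real.rpow_ofNat] at h
  have h2 := ENNReal.ofReal_tsum_of_nonneg (fun i => by positivity) h.summable
  rw [h.tsum_eq] at h2
  simpa [ENNReal.ofReal_pow, ofReal_norm] using h2

/-- The Hilbert-Schmidt norm may be computed in any orthonormal basis. -/
theorem norm_sq_eq_tsum {ι : Type*} (b : HilbertBasis ι ℂ H) (S : HilbertSchmidt H) :
    ‖S‖ ^ 2 = ∑' i, ‖toCLM H S (b i)‖ ^ 2 := by
  have hs := (isHilbertSchmidt_iff b _).1 S.isHilbertSchmidt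
  have h := enorm_sq_eq_tsum b S
  have h2 := ENNReal.ofReal_tsum_of_nonneg (fun i => by positivity) hs
  simp only [ENNReal.ofReal_pow (norm_nonneg _), ofReal_norm] at h2
  rw [← h2, ← ofReal_norm, ← ENNReal.ofReal_pow (norm_nonneg _)] at h
  exact (ENNReal.ofReal_eq_ofReal_iff (by positivity)
    (tsum_nonneg fun i => by positivity)).1 h

theorem norm_comp_left_le (U : H →L[ℂ] H) (S : HilbertSchmidt H) :
    ‖mk (U ∘L toCLM H S) (S.isHilbertSchmidt.comp_left U)‖ ≤ ‖U‖ * ‖S‖ := by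
  refine (pow_le_pow_iff_left₀ (norm_nonneg _) (by positivity) two_ne_zero).1 ?_
  have hs := (isHilbertSchmidt_iff (stdBasis H) _).1 S.isHilbertSchmidt
  rw [mul_pow, norm_sq_eq_tsum (stdBasis H), norm_sq_eq_tsum (stdBasis H), ← tsum_mul_left]
  refine Summable.tsum_le_tsum (fun i => ?_)
    ((isHilbertSchmidt_iff (stdBasis H) _).1 (S.isHilbertSchmidt.comp_left U))
    (hs.mul_left _)
  rw [← mul_pow]
  exact pow_le_pow_left₀ (norm_nonneg _) (U.le_opNorm _) 2

theorem norm_adjoint (S : HilbertSchmidt H) :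
    ‖mk (ContinuousLinearMap.adjoint (toCLM H S)) S.isHilbertSchmidt.adjoint‖ = ‖S‖ := by
  have h : ‖mk (ContinuousLinearMap.adjoint (toCLM H S)) S.isHilbertSchmidt.adjoint‖ₑ ^ 2
      = ‖S‖ₑ ^ 2 := by
    rw [enorm_sq_eq_tsum (stdBasis H), enorm_sq_eq_tsum (stdBasis H) S,
      tsum_enorm_sq_adjoint (stdBasis H) (stdBasis H) (toCLM H S)]
    rfl
  rw [← ofReal_norm, ← ofReal_norm, ← ENNReal.ofReal_pow (norm_nonneg _),
    ← ENNReal.ofReal_pow (norm_nonneg _),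
    ENNReal.ofReal_eq_ofReal_iff (by positivity) (by positivity)] at h
  exact (pow_left_inj₀ (norm_nonneg _) (norm_nonneg _) two_ne_zero).1 h

theorem norm_comp_right_le (V : H →L[ℂ] H) (S : HilbertSchmidt H) :
    ‖mk (toCLM H S ∘L V) (S.isHilbertSchmidt.comp_right V)‖ ≤ ‖V‖ * ‖S‖ := by
  rw [← norm_adjoint, ← norm_adjoint S, ← (ContinuousLinearMap.adjoint).norm_map V]
  refine le_trans (le_of_eq ?_) (norm_comp_left_le (ContinuousLinearMap.adjoint V) _)
  congr 1
  exact toCLM_injective (by simp [ContinuousLinearMap.adjoint_comp])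

theorem column_surjective {ι : Type*} (b : HilbertBasis ι ℂ H) :
    Function.Surjective (column b) := by
  intro f
  have hcs : ∀ x : H, (Summable fun i => ‖b.repr x i‖ * ‖f i‖) ∧
      ∑' i, ‖b.repr x i‖ * ‖f i‖ ≤ ‖b.repr x‖ * ‖f‖ := fun x => by
    have h := Real.summable_and_inner_le_Lp_mul_Lq_tsum_of_nonneg (p := 2) (q := 2)
      (by rw [Real.holderConjugate_iff]; norm_num)
      (fun i => norm_nonneg (b.repr x i)) (fun i => norm_nonneg (f i))
      (by simpa using (lp.memℓp (b.repr x)).summable (by norm_num))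
      (by simpa using (lp.memℓp f).summable (by norm_num))
    rw [lp.norm_eq_tsum_rpow (by norm_num) (b.repr x), lp.norm_eq_tsum_rpow (by norm_num) f]
    simpa using h
  have hsum : ∀ x : H, Summable fun i => ‖(b.repr x i) • f i‖ := fun x => by
    simp only [norm_smul]
    refine (hcs x).1
  let T : H →L[ℂ] H := LinearMap.mkContinuous
    { toFun := fun x => ∑' i, (b.repr x i) • f i
      map_add' := fun x y => by
        rw [← (hsum x).of_norm.tsum_add (hsum y).of_norm]
        exact tsum_congr fun i => by simp [add_smul]
      map_smul' := fun c x => by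
        rw [RingHom.id_apply, ← (hsum x).of_norm.tsum_const_smul c]
        exact tsum_congr fun i => by simp [mul_smul] }
    ‖f‖ (fun x => by
      refine (norm_tsum_le_tsum_norm (hsum x)).trans ?_
      simp only [norm_smul]
      have h := (hcs x).2
      rwa [LinearIsometryEquiv.norm_map, mul_comm] at h)
  have hT : ∀ i, T (b i) = f i := by
    classical
    intro i
    change ∑' j, (b.repr (b i) j) • f j = f i
    rw [tsum_eq_single i, b.repr_self, lp.single_apply_self, one_smul]
    intro j hj
    rw [b.repr_self, lp.single_apply_ne _ _ _ hj, zero_smul]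
  have hmem : IsHilbertSchmidt T := by
    rw [isHilbertSchmidt_iff_memℓp b]
    simp only [hT]
    exact lp.memℓp f
  refine ⟨mk T hmem, ?_⟩
  ext i
  exact hT i

instance instCompleteSpace : CompleteSpace (HilbertSchmidt H) := by
  have hiso : Isometry (column (stdBasis H)) :=
    AddMonoidHomClass.isometry_of_norm _ fun S => (norm_def S).symm
  rw [completeSpace_iff_isComplete_univ, ← isComplete_image_iff hiso.isUniformInducing,
    Set.image_univ, (column_surjective (stdBasis H)).range_eq]
  exact completeSpace_iff_isComplete_univ.1 inferInstance

/-- Left multiplication `L_U S = U S` on `C₂(H)`. -/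
def mulLeft (U : H →L[ℂ] H) : HilbertSchmidt H →L[ℂ] HilbertSchmidt H :=
  LinearMap.mkContinuous
    { toFun := fun S => mk (U ∘L toCLM H S) (S.isHilbertSchmidt.comp_left U)
      map_add' := fun S T => toCLM_injective (by simp)
      map_smul' := fun c S => toCLM_injective (by simp) }
    ‖U‖ (norm_comp_left_le U)

/-- Right multiplication `R_V S = S V` on `C₂(H)`. -/
def mulRight (V : H →L[ℂ] H) : HilbertSchmidt H →L[ℂ] HilbertSchmidt H :=
  LinearMap.mkContinuous
    { toFun := fun S => mk (toCLM H S ∘L V) (S.isHilbertSchmidt.comp_right V)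
      map_add' := fun S T => toCLM_injective (by simp)
      map_smul' := fun c S => toCLM_injective (by simp) }
    ‖V‖ (norm_comp_right_le V)

@[simp] theorem toCLM_mulLeft (U : H →L[ℂ] H) (S : HilbertSchmidt H) :
    toCLM H (mulLeft U S) = U ∘L toCLM H S := rfl

@[simp] theorem toCLM_mulRight (V : H →L[ℂ] H) (S : HilbertSchmidt H) :
    toCLM H (mulRight V S) = toCLM H S ∘L V := rfl

end HilbertSchmidt

/-! ### Backward shifts -/

/-- The backward shift `(x₀, x₁, …) ↦ (x₁, x₂, …)` on `ℓ²(ℤ₊, E)`. For `E = ℂ` this is the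
standard backward shift `B` on `ℓ²`, for an infinite-dimensional Hilbert space `E` it is the
backward shift `B_∞` of infinite multiplicity. -/
def backwardShift (E : Type*) [NormedAddCommGroup E] [InnerProductSpace ℂ E] :
    ℓ²(ℕ, E) →L[ℂ] ℓ²(ℕ, E) :=
  LinearMap.mkContinuous
    { toFun := fun x => ⟨fun n => x (n + 1), by
        have h := (lp.memℓp x).summable (by norm_num)
        exact memℓp_gen ((summable_nat_add_iff 1).2 h)⟩
      map_add' := fun x y => by
        ext n
        rfl
      map_smul' := fun c x => by
        ext n
        rfl }
    1 (fun x => by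
      refine lp.norm_le_of_tsum_le (by norm_num) (by positivity) ?_
      have h := (lp.memℓp x).summable (by norm_num)
      rw [one_mul, lp.norm_rpow_eq_tsum (by norm_num) x, h.tsum_eq_zero_add]
      exact le_add_of_nonneg_left (by positivity))

@[simp] theorem backwardShift_apply (E : Type*) [NormedAddCommGroup E] [InnerProductSpace ℂ E]
    (x : ℓ²(ℕ, E)) (n : ℕ) : backwardShift E x n = x (n + 1) := rfl

end

/-!
Write `B` for the backward shift on `ℓ²(ℕ, E)`. Since `B B* = 1`, the operators `U₁ = L_B` and
`U₂ = R_{B*}` on `C₂` have the right inverses `A₁ = L_{B*}` and `A₂ = R_B`, and left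
multiplications commute with right ones.

*Universality.* Suppose that `U A = 1` and that `W` embeds the whole space isometrically into
`ker U`. Given `T`, choose `c ≠ 0` small and let `V` solve `V = W + A V (c T)` (a Neumann series).
Then `U V = c V T`, and `V` is so close to the isometry `W` that it is an isomorphism onto a closed
subspace, which is the required invariant subspace (`isUniversalOperator_of_rightInverse`). For a
commuting pair `S₁, S₂`, let `W` map into the joint kernel and solve first `X = W + A₂ X (c S₂)`,
then `V = X + A₁ V (c S₁)`. Then `U₁ X = 0`, whence `U₁ V = c V S₁`, and `U₂ V - c V S₂` solves a
homogeneous equation whose only solution is zero (`isUniversalCommutingPair_of_rightInverse`).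

*The embedding `W`.* The space `C₂` is a separable Hilbert space, so it embeds isometrically into
every infinite-dimensional Hilbert space (`exists_linearIsometry_of_separableSpace`); rank one
operators show that the kernels, and for infinite-dimensional `E` also the joint kernel, are
infinite-dimensional.

*Scalar shift.* For `E = ℂ` the joint kernel is spanned by the matrix unit `e₀₀`
(`finrank_ker_inf_ker_backwardShift`). For a universal commuting pair, the pair `(0, 0)` forces the
joint kernel to contain a copy of the whole space (`IsUniversalCommutingPair.finiteDimensional`),
so the pair for the scalar shift is not universal.
-/

/-! ### Universality from right inverses -/

section Abstract

variable {E : Type*} [NormedAddCommGroup E] [NormedSpace ℂ E]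

/-- The equation `V = W + A V S` is solved by the Neumann series `∑ Aⁿ W Sⁿ`. With the bound
`1 / 8`, two successive solutions starting from a contraction still stay within distance `1 / 2`
of it. -/
theorem exists_eq_add_mul_mul {R : Type*} [NormedRing R] [NormedAlgebra ℂ R] [CompleteSpace R]
    (A S W : R) (h : ‖A‖ * ‖S‖ ≤ 1 / 8) :
    ∃ V : R, V = W + A * V * S ∧ ‖V - W‖ ≤ ‖W‖ / 7 := by
  have ht := (ContinuousLinearMap.opNorm_mulLeftRight_apply_apply_le ℂ R A S).trans h
  set t := ContinuousLinearMap.mulLeftRight ℂ R A S with ht_def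
  let u := Units.oneSub t (ht.trans_lt (by norm_num))
  have hV : (↑u⁻¹ : R →L[ℂ] R) W = W + A * (↑u⁻¹ : R →L[ℂ] R) W * S := by
    have h1 : (1 - t) ((↑u⁻¹ : R →L[ℂ] R) W) = W :=
      congrArg (fun f : R →L[ℂ] R => f W) u.mul_inv
    rw [sub_apply, one_apply_eq_self, sub_eq_iff_eq_add] at h1
    rw [ht_def, ContinuousLinearMap.mulLeftRight_apply] at h1
    exact h1
  set V := (↑u⁻¹ : R →L[ℂ] R) W
  have h2 : ‖V - W‖ ≤ 1 / 8 * ‖V‖ := by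
    have h3 : V - W = A * V * S := by rw [sub_eq_iff_eq_add']; exact hV
    rw [h3]
    calc ‖A * V * S‖ ≤ ‖A‖ * ‖V‖ * ‖S‖ :=
          (norm_mul_le _ _).trans (by gcongr; exact norm_mul_le _ _)
      _ = ‖A‖ * ‖S‖ * ‖V‖ := by ring
      _ ≤ _ := by gcongr
  have h4 : ‖V‖ ≤ ‖W‖ + ‖V - W‖ := by simpa using norm_add_le W (V - W)
  exact ⟨V, hV, by linarith⟩

/-- Uniqueness for the homogeneous equation `Y = A Y S`. -/
theorem eq_zero_of_eq_mul_mul {R : Type*} [NormedRing R] {A S Y : R}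
    (h : ‖A‖ * ‖S‖ ≤ 1 / 8) (hY : Y = A * Y * S) : Y = 0 := by
  have h1 : ‖Y‖ ≤ 1 / 8 * ‖Y‖ := by
    calc ‖Y‖ = ‖A * Y * S‖ := congrArg norm hY
      _ ≤ ‖A‖ * ‖Y‖ * ‖S‖ := (norm_mul_le _ _).trans (by gcongr; exact norm_mul_le _ _)
      _ = ‖A‖ * ‖S‖ * ‖Y‖ := by ring
      _ ≤ _ := by gcongr
  exact norm_le_zero_iff.1 (by linarith)

/-- An operator at distance at most `1 / 2` from an isometry is an isomorphism onto its range. -/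
theorem antilipschitz_of_near_isometry {W V : E →L[ℂ] E} (hW : ∀ x, ‖W x‖ = ‖x‖)
    (h : ‖V - W‖ ≤ 1 / 2) : AntilipschitzWith 2 V := by
  refine ContinuousLinearMap.antilipschitz_of_bound V fun x => ?_
  have h1 : ‖(V - W) x‖ ≤ 1 / 2 * ‖x‖ := (V - W).le_of_opNorm_le h x
  have h2 : ‖W x‖ ≤ ‖V x‖ + ‖(V - W) x‖ := by
    have := norm_sub_le (V x) ((V - W) x)
    simpa using this
  rw [hW] at h2
  push_cast
  linarith

/-- Two operators can be scaled by a common constant into a prescribed small range. -/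
theorem exists_smul_norm_mul_le (A₁ S₁ A₂ S₂ : E →L[ℂ] E) :
    ∃ c : ℂ, c ≠ 0 ∧ ‖A₁‖ * ‖c • S₁‖ ≤ 1 / 8 ∧ ‖A₂‖ * ‖c • S₂‖ ≤ 1 / 8 := by
  set k : ℝ := ‖A₁‖ * ‖S₁‖ + ‖A₂‖ * ‖S₂‖ + 1 with hk
  have h₁ : 0 ≤ ‖A₁‖ * ‖S₁‖ := by positivity
  have h₂ : 0 ≤ ‖A₂‖ * ‖S₂‖ := by positivity
  have hk0 : 0 < k := by positivity
  have hc : ‖((1 / (8 * k) : ℝ) : ℂ)‖ = 1 / (8 * k) := by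
    rw [Complex.norm_real, Real.norm_of_nonneg (by positivity)]
  refine ⟨((1 / (8 * k) : ℝ) : ℂ), ?_, ?_, ?_⟩
  · exact_mod_cast (by positivity : (1 / (8 * k) : ℝ) ≠ 0)
  · rw [norm_smul, hc, mul_left_comm, div_mul_eq_mul_div, div_le_div_iff₀ (by positivity)
      (by norm_num)]
    linarith
  · rw [norm_smul, hc, mul_left_comm, div_mul_eq_mul_div, div_le_div_iff₀ (by positivity)
      (by norm_num)]
    linarith

/-- The pair `(0, 0)` shows that the joint kernel of a universal commuting pair contains an
isomorphic copy of the whole space. -/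
theorem IsUniversalCommutingPair.finiteDimensional {U₁ U₂ : E →L[ℂ] E}
    (h : IsUniversalCommutingPair U₁ U₂) [FiniteDimensional ℂ ↥(U₁.ker ⊓ U₂.ker)] :
    FiniteDimensional ℂ E := by
  obtain ⟨c, M, V, -, -, -, -, h₁, h₂⟩ := h.2 0 0 (Commute.zero_left 0)
  have hk : ∀ x, M.subtype (V x) ∈ U₁.ker ⊓ U₂.ker := fun x =>
    ⟨by simpa using h₁ x, by simpa using h₂ x⟩
  refine Module.Finite.of_injective
    ((M.subtype ∘ₗ V.toLinearEquiv.toLinearMap).codRestrict (U₁.ker ⊓ U₂.ker) hk) fun x y hxy => ?_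
  have h : M.subtype (V x) = M.subtype (V y) := congrArg (U₁.ker ⊓ U₂.ker).subtype hxy
  exact V.injective (Subtype.ext h)

variable [CompleteSpace E]

/-- An operator with a bounded right inverse whose kernel contains an isometric copy of the whole
space is universal. -/
theorem isUniversalOperator_of_rightInverse {U A W : E →L[ℂ] E} (hUA : U * A = 1)
    (hUW : U * W = 0) (hW : ∀ x, ‖W x‖ = ‖x‖) : IsUniversalOperator U := by
  intro T
  obtain ⟨c, hc, h₁, -⟩ := exists_smul_norm_mul_le A T A T
  obtain ⟨V, hV, hVW⟩ := exists_eq_add_mul_mul A (c • T) W h₁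
  have hW1 : ‖W‖ ≤ 1 := W.opNorm_le_bound zero_le_one fun x => by rw [hW, one_mul]
  have hanti := antilipschitz_of_near_isometry hW (V := V) (by linarith)
  have hcl : IsClosed (Set.range V) := hanti.isClosed_range V.uniformContinuous
  have hUV : U * V = V * (c • T) := by
    calc U * V = U * W + U * A * V * (c • T) := by
          conv_lhs => rw [hV]
          simp only [mul_add, mul_assoc]
      _ = V * (c • T) := by rw [hUW, hUA, zero_add, one_mul]
  have hUVx : ∀ x, U (V x) = V (c • T x) := fun x => by
    simpa using congrArg (fun f : E →L[ℂ] E => f x) hUV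
  refine ⟨V.range, ?_, c, (V.equivRange hanti.injective hcl).symm, hcl, hc, ?_⟩
  · rintro _ ⟨x, rfl⟩
    exact ⟨c • T x, (hUVx x).symm⟩
  · rintro ⟨_, x, rfl⟩
    rw [ContinuousLinearEquiv.symm_apply_eq]
    have hx : (V.equivRange hanti.injective hcl).symm ⟨V x, x, rfl⟩ = x := by
      rw [ContinuousLinearEquiv.symm_apply_eq]
      rfl
    apply Subtype.ext
    change U (V x) = V (c • T ((V.equivRange hanti.injective hcl).symm ⟨V x, x, rfl⟩))
    rw [hx]
    exact hUVx x

/-- Two-variable version of `isUniversalOperator_of_rightInverse`: here `W` embeds the space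
isometrically into the joint kernel, and each right inverse commutes with the other operator. -/
theorem isUniversalCommutingPair_of_rightInverse {U₁ U₂ A₁ A₂ W : E →L[ℂ] E}
    (hU : Commute U₁ U₂) (h₁ : U₁ * A₁ = 1) (h₂ : U₂ * A₂ = 1) (h₁₂ : Commute U₁ A₂)
    (h₂₁ : Commute U₂ A₁) (hW₁ : U₁ * W = 0) (hW₂ : U₂ * W = 0) (hW : ∀ x, ‖W x‖ = ‖x‖) :
    IsUniversalCommutingPair U₁ U₂ := by
  refine ⟨hU, fun S₁ S₂ hS => ?_⟩
  obtain ⟨c, hc, hn₁, hn₂⟩ := exists_smul_norm_mul_le A₁ S₁ A₂ S₂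
  set T₁ := c • S₁ with hT₁
  set T₂ := c • S₂ with hT₂
  have hT : Commute T₁ T₂ := (hS.smul_left c).smul_right c
  obtain ⟨X, hX, hXW⟩ := exists_eq_add_mul_mul A₂ T₂ W hn₂
  obtain ⟨V, hV, hVX⟩ := exists_eq_add_mul_mul A₁ T₁ X hn₁
  have hU₁X : U₁ * X = 0 := by
    refine eq_zero_of_eq_mul_mul hn₂ ?_
    calc U₁ * X = U₁ * W + U₁ * A₂ * X * T₂ := by
          conv_lhs => rw [hX]
          simp only [mul_add, mul_assoc]
      _ = A₂ * (U₁ * X) * T₂ := by rw [hW₁, h₁₂.eq, zero_add]; simp only [mul_assoc]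
  have hU₂X : U₂ * X = X * T₂ := by
    calc U₂ * X = U₂ * W + U₂ * A₂ * X * T₂ := by
          conv_lhs => rw [hX]
          simp only [mul_add, mul_assoc]
      _ = X * T₂ := by rw [hW₂, h₂, zero_add, one_mul]
  have hU₁V : U₁ * V = V * T₁ := by
    calc U₁ * V = U₁ * X + U₁ * A₁ * V * T₁ := by
          conv_lhs => rw [hV]
          simp only [mul_add, mul_assoc]
      _ = V * T₁ := by rw [hU₁X, h₁, zero_add, one_mul]
  have hU₂V : U₂ * V = V * T₂ := by
    -- the defect `U₂ V - V T₂` solves the homogeneous equation `Y = A₁ Y T₁`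
    refine sub_eq_zero.1 (eq_zero_of_eq_mul_mul hn₁ ?_)
    have e₁ : U₂ * V = X * T₂ + A₁ * (U₂ * V) * T₁ := by
      calc U₂ * V = U₂ * X + U₂ * A₁ * V * T₁ := by
            conv_lhs => rw [hV]
            simp only [mul_add, mul_assoc]
        _ = _ := by rw [hU₂X, h₂₁.eq]; simp only [mul_assoc]
    have e₂ : V * T₂ = X * T₂ + A₁ * (V * T₂) * T₁ := by
      calc V * T₂ = X * T₂ + A₁ * V * (T₁ * T₂) := by
            conv_lhs => rw [hV]
            simp only [add_mul, mul_assoc]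
        _ = _ := by rw [hT.eq]; simp only [mul_assoc]
    calc U₂ * V - V * T₂ = (X * T₂ + A₁ * (U₂ * V) * T₁) - (X * T₂ + A₁ * (V * T₂) * T₁) := by
          rw [← e₁, ← e₂]
      _ = _ := by rw [mul_sub, sub_mul]; abel
  have hW1 : ‖W‖ ≤ 1 := W.opNorm_le_bound zero_le_one fun x => by rw [hW, one_mul]
  have hVW : ‖V - W‖ ≤ 1 / 2 := by
    have e₁ : ‖V - W‖ ≤ ‖V - X‖ + ‖X - W‖ := norm_sub_le_norm_sub_add_norm_sub _ _ _
    have e₂ : ‖X‖ ≤ ‖W‖ + ‖X - W‖ := by simpa using norm_add_le W (X - W)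
    linarith
  have hanti := antilipschitz_of_near_isometry hW hVW
  have hcl : IsClosed (Set.range V) := hanti.isClosed_range V.uniformContinuous
  have hx₁ : ∀ x, U₁ (V x) = c • V (S₁ x) := fun x => by
    simpa [hT₁] using congrArg (fun f : E →L[ℂ] E => f x) hU₁V
  have hx₂ : ∀ x, U₂ (V x) = c • V (S₂ x) := fun x => by
    simpa [hT₂] using congrArg (fun f : E →L[ℂ] E => f x) hU₂V
  refine ⟨c, V.range, V.equivRange hanti.injective hcl, hc, hcl, ?_, ?_, hx₁, hx₂⟩
  · rintro _ ⟨x, rfl⟩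
    exact ⟨c • S₁ x, by simpa using (hx₁ x).symm⟩
  · rintro _ ⟨x, rfl⟩
    exact ⟨c • S₂ x, by simpa using (hx₂ x).symm⟩

end Abstract

/-! ### Isometric embeddings of separable Hilbert spaces -/

theorem Orthonormal.countable_of_separableSpace {E ι : Type*} [NormedAddCommGroup E]
    [InnerProductSpace ℂ E] [TopologicalSpace.SeparableSpace E] {v : ι → E}
    (hv : Orthonormal ℂ v) : Countable ι := by
  -- distinct members lie at distance `√2`, so the balls of radius `1/2` around them are disjoint
  refine Pairwise.countable_of_isOpen_disjoint (s := fun i => Metric.ball (v i) (1 / 2)) ?_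
    (fun i => Metric.isOpen_ball) (fun i => ⟨v i, Metric.mem_ball_self (by norm_num)⟩)
  intro i j hij
  refine Metric.ball_disjoint_ball ?_
  rw [dist_eq_norm]
  have h : ‖v i - v j‖ ^ 2 = 2 := by
    rw [@norm_sub_sq ℂ, hv.2 hij, hv.1 i, hv.1 j]
    norm_num
  nlinarith [norm_nonneg (v i - v j)]

theorem lp.separableSpace_two {ι : Type*} [Countable ι] {F : Type*} [NormedAddCommGroup F]
    [InnerProductSpace ℂ F] [TopologicalSpace.SeparableSpace F] :
    TopologicalSpace.SeparableSpace ℓ²(ι, F) := by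
  classical
  have h1 : TopologicalSpace.IsSeparable
      (⋃ i, Set.range (lp.singleContinuousLinearMap ℂ (fun _ : ι => F) 2 i)) :=
    TopologicalSpace.IsSeparable.iUnion fun i =>
      TopologicalSpace.isSeparable_range (ContinuousLinearMap.continuous _)
  have h2 := (h1.span (R := ℂ)).closure
  rw [← TopologicalSpace.isSeparable_univ_iff]
  refine h2.mono fun f _ => ?_
  refine mem_closure_of_tendsto (lp.hasSum_single (by norm_num) f) (Filter.Eventually.of_forall ?_)
  exact fun s => Submodule.sum_mem _ fun i _ =>
    Submodule.subset_span (Set.mem_iUnion.2 ⟨i, f i, rfl⟩)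

theorem exists_linearIsometry_of_separableSpace (E F : Type*) [NormedAddCommGroup E]
    [InnerProductSpace ℂ E] [CompleteSpace E] [TopologicalSpace.SeparableSpace E]
    [NormedAddCommGroup F] [InnerProductSpace ℂ F] [CompleteSpace F]
    (hF : ¬ FiniteDimensional ℂ F) : Nonempty (E →ₗᵢ[ℂ] F) := by
  obtain ⟨w, b, -⟩ := exists_hilbertBasis ℂ E
  obtain ⟨w', b', -⟩ := exists_hilbertBasis ℂ F
  have hw : Countable w := b.orthonormal.countable_of_separableSpace
  have hw' : Infinite w' := by
    by_contra hfin
    rw [not_infinite_iff_finite] at hfin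
    have := Fintype.ofFinite w'
    exact hF (b'.toOrthonormalBasis.toBasis.finiteDimensional_of_finite)
  obtain ⟨f⟩ : Nonempty (w ↪ w') := by
    obtain ⟨g, hg⟩ := exists_injective_nat w
    exact ⟨(⟨g, hg⟩ : w ↪ ℕ).trans (Infinite.natEmbedding w')⟩
  have ho : Orthonormal ℂ (b' ∘ f) := b'.orthonormal.comp f f.injective
  exact ⟨ho.orthogonalFamily.linearIsometry.comp b.repr.toLinearIsometry⟩

namespace HilbertSchmidt

variable {K : Type*} [NormedAddCommGroup K] [InnerProductSpace ℂ K] [CompleteSpace K]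

/-! ### Separability and rank one operators -/

instance instSeparableSpace [TopologicalSpace.SeparableSpace K] :
    TopologicalSpace.SeparableSpace (HilbertSchmidt K) := by
  have hc : Countable (exists_hilbertBasis ℂ K).choose :=
    (stdBasis K).orthonormal.countable_of_separableSpace
  have := lp.separableSpace_two (ι := (exists_hilbertBasis ℂ K).choose) (F := K)
  have hiso : Isometry (column (stdBasis K)) :=
    AddMonoidHomClass.isometry_of_norm _ fun S => (norm_def S).symm
  have : SecondCountableTopology ℓ²((exists_hilbertBasis ℂ K).choose, K) :=
    UniformSpace.secondCountable_of_separable _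
  have := hiso.isEmbedding.secondCountableTopology
  infer_instance

theorem _root_.isHilbertSchmidt_rankOne (x y : K) :
    IsHilbertSchmidt (InnerProductSpace.rankOne ℂ x y) := by
  obtain ⟨w, b, -⟩ := exists_hilbertBasis ℂ K
  refine ⟨w, b, ?_⟩
  have h : Summable fun i => ‖inner ℂ (b i) y‖ ^ 2 := by
    rw [summable_norm_sq_iff, hilbertBasis_tsum_enorm_inner_sq]
    simp
  refine (h.mul_right (‖x‖ ^ 2)).congr fun i => ?_
  rw [InnerProductSpace.rankOne_apply, norm_smul, mul_pow, norm_inner_symm]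

/-- The rank one operator `z ↦ ⟪y, z⟫ x` as an element of `C₂(K)`. -/
noncomputable def rankOne (x y : K) : HilbertSchmidt K :=
  mk (InnerProductSpace.rankOne ℂ x y) (isHilbertSchmidt_rankOne x y)

@[simp] theorem toCLM_rankOne (x y : K) :
    toCLM K (rankOne x y) = InnerProductSpace.rankOne ℂ x y := rfl

theorem mem_ker_mulLeft {U : K →L[ℂ] K} {S : HilbertSchmidt K} :
    S ∈ (mulLeft U).ker ↔ U ∘L toCLM K S = 0 :=
  ⟨fun h => congrArg (toCLM K) h, fun h => toCLM_injective h⟩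

theorem mem_ker_mulRight {V : K →L[ℂ] K} {S : HilbertSchmidt K} :
    S ∈ (mulRight V).ker ↔ toCLM K S ∘L V = 0 :=
  ⟨fun h => congrArg (toCLM K) h, fun h => toCLM_injective h⟩

theorem rankOne_mem_ker_mulLeft {U : K →L[ℂ] K} {x : K} (hx : U x = 0) (y : K) :
    rankOne x y ∈ (mulLeft U).ker := by
  rw [mem_ker_mulLeft, toCLM_rankOne, InnerProductSpace.comp_rankOne, hx]
  simp

theorem rankOne_mem_ker_mulRight {B : K →L[ℂ] K} {y : K} (hy : B y = 0) (x : K) :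
    rankOne x y ∈ (mulRight (ContinuousLinearMap.adjoint B)).ker := by
  rw [mem_ker_mulRight, toCLM_rankOne, InnerProductSpace.rankOne_comp,
    ContinuousLinearMap.adjoint_adjoint, hy]
  simp

/-- A subspace of `C₂(K)` that contains `x ⊗ y` for a fixed `y ≠ 0` and all `x` in an
infinite-dimensional space, given as the range of `f`, is infinite-dimensional. -/
theorem not_finiteDimensional_of_rankOne_mem {G : Type*} [AddCommGroup G] [Module ℂ G]
    (hG : ¬ FiniteDimensional ℂ G) {N : Submodule ℂ (HilbertSchmidt K)} (f : G →ₗ[ℂ] K)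
    (hf : Function.Injective f) {y : K} (hy : y ≠ 0) (h : ∀ g, rankOne (f g) y ∈ N) :
    ¬ FiniteDimensional ℂ N := by
  intro hN
  let F : G →ₗ[ℂ] N :=
    { toFun := fun g => ⟨rankOne (f g) y, h g⟩
      map_add' := fun g g' => Subtype.ext (toCLM_injective (by simp))
      map_smul' := fun c g => Subtype.ext (toCLM_injective (by simp)) }
  refine hG (Module.Finite.of_injective F ((injective_iff_map_eq_zero F).2 fun g hg => ?_))
  have h0 : InnerProductSpace.rankOne ℂ (f g) y = 0 :=
    congrArg (fun S : N => toCLM K S.1) hg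
  exact (injective_iff_map_eq_zero f).1 hf g
    ((InnerProductSpace.rankOne_eq_zero.1 h0).resolve_right hy)

/-- The conjugate-linear map `S ↦ S* x` sends a space of operators containing all `x ⊗ y` onto
`K`. -/
theorem not_finiteDimensional_of_forall_rankOne_mem (hK : ¬ FiniteDimensional ℂ K)
    {N : Submodule ℂ (HilbertSchmidt K)} {x : K} (hx : ‖x‖ = 1) (h : ∀ y, rankOne x y ∈ N) :
    ¬ FiniteDimensional ℂ N := by
  intro hN
  let F : N →ₗ⋆[ℂ] K :=
    { toFun := fun S => ContinuousLinearMap.adjoint (toCLM K S.1) x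
      map_add' := fun S T => by simp
      map_smul' := fun c S => by simp [map_smulₛₗ] }
  refine hK (Module.Finite.of_surjective F fun y => ⟨⟨rankOne x y, h y⟩, ?_⟩)
  simp [F, hx]

theorem commute_mulLeft_mulRight (U V : K →L[ℂ] K) : Commute (mulLeft U) (mulRight V) := by
  ext S
  rfl

theorem mulLeft_mul_mulLeft {U V : K →L[ℂ] K} (h : U * V = 1) : mulLeft U * mulLeft V = 1 := by
  ext S
  refine toCLM_injective ?_
  change (U * V) * toCLM K S = toCLM K S
  rw [h, one_mul]

theorem mulRight_mul_mulRight {U V : K →L[ℂ] K} (h : U * V = 1) :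
    mulRight V * mulRight U = 1 := by
  ext S
  refine toCLM_injective ?_
  change toCLM K S * U * V = toCLM K S
  rw [mul_assoc, h, mul_one]

theorem not_finiteDimensional (hK : ¬ FiniteDimensional ℂ K) :
    ¬ FiniteDimensional ℂ (HilbertSchmidt K) := by
  intro hfin
  have : Nontrivial K := by
    by_contra hn
    rw [not_nontrivial_iff_subsingleton] at hn
    exact hK inferInstance
  obtain ⟨x, hx⟩ := exists_norm_eq K zero_le_one
  exact not_finiteDimensional_of_forall_rankOne_mem hK (N := ⊤) hx (fun _ => trivial) inferInstance

end HilbertSchmidt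

/-! ### The backward shift -/

section Shift

variable {E : Type*} [NormedAddCommGroup E] [InnerProductSpace ℂ E]

theorem backwardShift_single_zero (x : E) : backwardShift E (lp.single 2 0 x) = 0 := by
  ext n
  simp

theorem backwardShift_single_succ (n : ℕ) (x : E) :
    backwardShift E (lp.single 2 (n + 1) x) = lp.single 2 n x := by
  ext m
  simp [lp.single_apply, Pi.single_apply]

theorem lp.inner_single_nat (n : ℕ) (v : E) (x : ℓ²(ℕ, E)) :
    inner ℂ (lp.single 2 n v : ℓ²(ℕ, E)) x = inner ℂ v (x n) :=
  lp.inner_single_left (𝕜 := ℂ) (G := fun _ : ℕ => E) n v x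

theorem adjoint_backwardShift_apply_zero [CompleteSpace E] (x : ℓ²(ℕ, E)) :
    ContinuousLinearMap.adjoint (backwardShift E) x 0 = 0 := by
  refine ext_inner_left ℂ fun v : E => ?_
  have h := ContinuousLinearMap.adjoint_inner_right (backwardShift E) (lp.single 2 0 v) x
  rw [backwardShift_single_zero, inner_zero_left] at h
  exact (lp.inner_single_nat 0 v _).symm.trans (h.trans (inner_zero_right v).symm)

theorem adjoint_backwardShift_apply_succ [CompleteSpace E] (x : ℓ²(ℕ, E)) (n : ℕ) :
    ContinuousLinearMap.adjoint (backwardShift E) x (n + 1) = x n := by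
  refine ext_inner_left ℂ fun v : E => ?_
  have h := ContinuousLinearMap.adjoint_inner_right (backwardShift E) (lp.single 2 (n + 1) v) x
  rw [backwardShift_single_succ] at h
  exact (lp.inner_single_nat (n + 1) v _).symm.trans (h.trans (lp.inner_single_nat n v x))

/-- `1 - B* B` is the projection onto the coordinate `x₀`. -/
theorem sub_single_eq_adjoint_backwardShift [CompleteSpace E] (x : ℓ²(ℕ, E)) :
    x - lp.single 2 0 (x 0) =
      ContinuousLinearMap.adjoint (backwardShift E) (backwardShift E x) := by
  ext n
  rw [lp.coeFn_sub, Pi.sub_apply]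
  cases n with
  | zero => rw [adjoint_backwardShift_apply_zero, lp.single_apply_self, sub_self]
  | succ n =>
    rw [adjoint_backwardShift_apply_succ, backwardShift_apply,
      lp.single_apply_ne _ _ _ n.succ_ne_zero, sub_zero]

theorem backwardShift_mul_adjoint [CompleteSpace E] :
    backwardShift E * ContinuousLinearMap.adjoint (backwardShift E) = 1 := by
  ext x n
  exact (adjoint_backwardShift_apply_succ x n)

theorem lp.single_ne_zero {F : Type*} [NormedAddCommGroup F] {v : F} (hv : v ≠ 0) (n : ℕ) :
    (lp.single 2 n v : ℓ²(ℕ, F)) ≠ 0 := by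
  rw [← norm_ne_zero_iff, lp.norm_single (by norm_num)]
  exact norm_ne_zero_iff.2 hv

theorem lp.not_finiteDimensional_nat [Nontrivial E] : ¬ FiniteDimensional ℂ ℓ²(ℕ, E) := by
  intro h
  obtain ⟨v, hv⟩ := exists_norm_eq E zero_le_one
  have ho : Orthonormal ℂ fun n : ℕ => (lp.single 2 n v : ℓ²(ℕ, E)) := by
    rw [orthonormal_iff_ite]
    intro i j
    rw [lp.inner_single_left, lp.single_apply, Pi.single_apply]
    split_ifs <;> simp_all
  exact Set.infinite_univ.not_finite (Set.finite_univ_iff.2 ho.linearIndependent.finite)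

end Shift

/-! ### Multiplication by backward shifts -/

open HilbertSchmidt ContinuousLinearMap

section Multiplication

variable {E : Type*} [NormedAddCommGroup E] [InnerProductSpace ℂ E] [CompleteSpace E]

theorem HilbertSchmidt.exists_isometry_into {K : Type*} [NormedAddCommGroup K]
    [InnerProductSpace ℂ K] [CompleteSpace K] [TopologicalSpace.SeparableSpace K]
    {N : Submodule ℂ (HilbertSchmidt K)} (hc : IsClosed (N : Set (HilbertSchmidt K)))
    (hN : ¬ FiniteDimensional ℂ N) :
    ∃ W : HilbertSchmidt K →L[ℂ] HilbertSchmidt K, (∀ x, ‖W x‖ = ‖x‖) ∧ ∀ x, W x ∈ N := by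
  have : CompleteSpace N := hc.completeSpace_coe
  obtain ⟨j⟩ := exists_linearIsometry_of_separableSpace (HilbertSchmidt K) N hN
  exact ⟨N.subtypeL ∘L j.toContinuousLinearMap, fun x => j.norm_map x, fun x => (j x).2⟩

theorem backwardShift_isUniversalOperator_mulLeft [Nontrivial E]
    [TopologicalSpace.SeparableSpace E] :
    IsUniversalOperator (mulLeft (backwardShift E)) := by
  have := lp.separableSpace_two (ι := ℕ) (F := E)
  obtain ⟨v, hv⟩ := exists_norm_eq E zero_le_one
  obtain ⟨W, hW, hWk⟩ := exists_isometry_into (isClosed_ker (mulLeft (backwardShift E)))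
    (not_finiteDimensional_of_forall_rankOne_mem lp.not_finiteDimensional_nat
      (x := lp.single 2 0 v) (by rw [lp.norm_single (by norm_num), hv])
      (rankOne_mem_ker_mulLeft (backwardShift_single_zero v)))
  exact isUniversalOperator_of_rightInverse (mulLeft_mul_mulLeft backwardShift_mul_adjoint)
    (ContinuousLinearMap.ext hWk) hW

theorem backwardShift_isUniversalOperator_mulRight [Nontrivial E]
    [TopologicalSpace.SeparableSpace E] :
    IsUniversalOperator (mulRight (adjoint (backwardShift E))) := by
  have := lp.separableSpace_two (ι := ℕ) (F := E)
  obtain ⟨v, hv⟩ := exists_ne (0 : E)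
  obtain ⟨W, hW, hWk⟩ := exists_isometry_into (isClosed_ker (mulRight (adjoint (backwardShift E))))
    (not_finiteDimensional_of_rankOne_mem lp.not_finiteDimensional_nat LinearMap.id
      Function.injective_id (lp.single_ne_zero hv 0)
      (rankOne_mem_ker_mulRight (backwardShift_single_zero v)))
  exact isUniversalOperator_of_rightInverse (mulRight_mul_mulRight backwardShift_mul_adjoint)
    (ContinuousLinearMap.ext hWk) hW

/-- The joint kernel contains all `(h ⊗ v) e₀₀`, with `h` in `E` and `v` fixed. -/
theorem not_finiteDimensional_ker_inf_ker (hE : ¬ FiniteDimensional ℂ E) :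
    ¬ FiniteDimensional ℂ
      ↥((mulLeft (backwardShift E)).ker ⊓ (mulRight (adjoint (backwardShift E))).ker) := by
  have : Nontrivial E := by
    by_contra hn
    rw [not_nontrivial_iff_subsingleton] at hn
    exact hE inferInstance
  obtain ⟨v, hv⟩ := exists_ne (0 : E)
  refine not_finiteDimensional_of_rankOne_mem hE (lp.lsingle (𝕜 := ℂ) (E := fun _ : ℕ => E) 2 0)
    ?_ (lp.single_ne_zero hv 0) fun g => ⟨rankOne_mem_ker_mulLeft (backwardShift_single_zero g) _,
      rankOne_mem_ker_mulRight (backwardShift_single_zero v) _⟩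
  refine (injective_iff_map_eq_zero _).2 fun g hg => ?_
  by_contra h0
  exact lp.single_ne_zero h0 0 hg

theorem backwardShift_isUniversalCommutingPair (hE : ¬ FiniteDimensional ℂ E)
    [TopologicalSpace.SeparableSpace E] :
    IsUniversalCommutingPair (mulLeft (backwardShift E))
      (mulRight (adjoint (backwardShift E))) := by
  have := lp.separableSpace_two (ι := ℕ) (F := E)
  obtain ⟨W, hW, hWk⟩ := exists_isometry_into
    ((isClosed_ker (mulLeft (backwardShift E))).inter
      (isClosed_ker (mulRight (adjoint (backwardShift E)))))
    (not_finiteDimensional_ker_inf_ker hE)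
  exact isUniversalCommutingPair_of_rightInverse (commute_mulLeft_mulRight _ _)
    (mulLeft_mul_mulLeft backwardShift_mul_adjoint)
    (mulRight_mul_mulRight backwardShift_mul_adjoint)
    (commute_mulLeft_mulRight _ _) (commute_mulLeft_mulRight _ _).symm
    (ContinuousLinearMap.ext fun x => (hWk x).1) (ContinuousLinearMap.ext fun x => (hWk x).2) hW

/-- If `U₁` has a right inverse `A₁` commuting with `U₂`, then `S = (S - A₁ U₁ S) + A₁ U₁ S`
splits `ker (U₁ U₂)`. -/
theorem ker_comp_eq_sup_of_rightInverse {F : Type*} [NormedAddCommGroup F] [NormedSpace ℂ F]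
    {U₁ U₂ A₁ : F →L[ℂ] F} (hU : Commute U₁ U₂) (h₁ : U₁ * A₁ = 1) (h₂₁ : Commute U₂ A₁) :
    (U₁ ∘L U₂).ker = U₁.ker ⊔ U₂.ker := by
  have e₁ : ∀ x, U₁ (A₁ x) = x := fun x => congrArg (fun f : F →L[ℂ] F => f x) h₁
  have e₂ : ∀ x, U₂ (A₁ x) = A₁ (U₂ x) := fun x => congrArg (fun f : F →L[ℂ] F => f x) h₂₁.eq
  have e₃ : ∀ x, U₁ (U₂ x) = U₂ (U₁ x) := fun x => congrArg (fun f : F →L[ℂ] F => f x) hU.eq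
  apply le_antisymm
  · intro x hx
    have hx' : U₁ (U₂ x) = 0 := hx
    refine Submodule.mem_sup.2 ⟨x - A₁ (U₁ x), ?_, A₁ (U₁ x), ?_, sub_add_cancel _ _⟩
    · change U₁ (x - A₁ (U₁ x)) = 0
      rw [map_sub, e₁, sub_self]
    · change U₂ (A₁ (U₁ x)) = 0
      rw [e₂, ← e₃, hx', map_zero]
  · refine sup_le (fun x hx => ?_) (fun x hx => ?_)
    · have hx' : U₁ x = 0 := hx
      change U₁ (U₂ x) = 0
      rw [e₃, hx', map_zero]
    · have hx' : U₂ x = 0 := hx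
      change U₁ (U₂ x) = 0
      rw [hx', map_zero]

theorem surjective_of_mul_eq_one {F : Type*} [NormedAddCommGroup F] [NormedSpace ℂ F]
    {U A : F →L[ℂ] F} (h : U * A = 1) : Function.Surjective U := fun x =>
  ⟨A x, congrArg (fun f : F →L[ℂ] F => f x) h⟩

end Multiplication

/-- For the scalar shift the joint kernel is spanned by the matrix unit `e₀₀`. -/
theorem finrank_ker_inf_ker_backwardShift :
    Module.finrank ℂ ↥((mulLeft (backwardShift ℂ)).ker ⊓
      (mulRight (adjoint (backwardShift ℂ))).ker) = 1 := by
  set e : ℕ → ℓ²(ℕ, ℂ) := fun n => lp.single 2 n 1 with he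
  have hB : backwardShift ℂ (e 0) = 0 := backwardShift_single_zero 1
  have he0 : e 0 ≠ 0 := lp.single_ne_zero one_ne_zero 0
  have hadj : ∀ x : ℓ²(ℕ, ℂ), x - x 0 • e 0 = adjoint (backwardShift ℂ) (backwardShift ℂ x) :=
    fun x => by
      rw [← sub_single_eq_adjoint_backwardShift, he]
      dsimp only
      rw [← lp.single_smul, smul_eq_mul, mul_one]
  have hne : rankOne (e 0) (e 0) ≠ 0 := fun h => by
    have h₁ := congrArg (toCLM ℓ²(ℕ, ℂ)) h
    rw [map_zero, toCLM_rankOne] at h₁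
    exact InnerProductSpace.rankOne_ne_zero he0 he0 h₁
  suffices h : (mulLeft (backwardShift ℂ)).ker ⊓ (mulRight (adjoint (backwardShift ℂ))).ker =
      Submodule.span ℂ {rankOne (e 0) (e 0)} by
    rw [h, finrank_span_singleton hne]
  apply le_antisymm
  · rintro S ⟨hL, hR⟩
    rw [SetLike.mem_coe] at hL hR
    rw [mem_ker_mulLeft] at hL
    rw [mem_ker_mulRight] at hR
    -- `S` kills the range of `B*`, hence it depends on the coordinate `x₀` only
    have hS : ∀ x, toCLM _ S x = x 0 • toCLM _ S (e 0) := fun x => by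
      rw [← map_smul, ← sub_eq_zero, ← map_sub, hadj]
      exact congrArg (fun f : ℓ²(ℕ, ℂ) →L[ℂ] ℓ²(ℕ, ℂ) => f (backwardShift ℂ x)) hR
    -- `S e₀` lies in the kernel of `B`, which is spanned by `e₀`
    have hS0 : toCLM _ S (e 0) = toCLM _ S (e 0) 0 • e 0 := by
      rw [← sub_eq_zero, hadj]
      have h : backwardShift ℂ (toCLM _ S (e 0)) = 0 :=
        congrArg (fun f : ℓ²(ℕ, ℂ) →L[ℂ] ℓ²(ℕ, ℂ) => f (e 0)) hL
      rw [h, map_zero]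
    refine Submodule.mem_span_singleton.2
      ⟨toCLM _ S (e 0) 0, toCLM_injective (ContinuousLinearMap.ext fun x => ?_)⟩
    have hi : inner ℂ (e 0) x = x 0 :=
      (lp.inner_single_nat 0 (1 : ℂ) x).trans (by simp)
    change toCLM _ S (e 0) 0 • inner ℂ (e 0) x • e 0 = toCLM _ S x
    rw [hi, hS x, smul_comm, ← hS0]
  · rw [Submodule.span_singleton_le_iff_mem]
    exact ⟨rankOne_mem_ker_mulLeft hB _, rankOne_mem_ker_mulRight hB _⟩

theorem mainTheorem3 (H : Type*) [NormedAddCommGroup H] [InnerProductSpace ℂ H]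
    [CompleteSpace H] [TopologicalSpace.SeparableSpace H] (hH : ¬ FiniteDimensional ℂ H) :
    (IsUniversalOperator (HilbertSchmidt.mulLeft (backwardShift ℂ)) ∧
      IsUniversalOperator
        (HilbertSchmidt.mulRight (ContinuousLinearMap.adjoint (backwardShift ℂ))) ∧
      IsUniversalOperator (HilbertSchmidt.mulLeft (backwardShift H)) ∧
      IsUniversalOperator
        (HilbertSchmidt.mulRight (ContinuousLinearMap.adjoint (backwardShift H)))) ∧
    (Commute (HilbertSchmidt.mulLeft (backwardShift ℂ))
        (HilbertSchmidt.mulRight (ContinuousLinearMap.adjoint (backwardShift ℂ))) ∧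
      Module.finrank ℂ
        ↥((HilbertSchmidt.mulLeft (backwardShift ℂ)).ker ⊓
          (HilbertSchmidt.mulRight (ContinuousLinearMap.adjoint (backwardShift ℂ))).ker) = 1 ∧
      ¬ IsUniversalCommutingPair (HilbertSchmidt.mulLeft (backwardShift ℂ))
        (HilbertSchmidt.mulRight (ContinuousLinearMap.adjoint (backwardShift ℂ)))) ∧
    (IsUniversalCommutingPair (HilbertSchmidt.mulLeft (backwardShift H))
        (HilbertSchmidt.mulRight (ContinuousLinearMap.adjoint (backwardShift H))) ∧
      Function.Surjective (HilbertSchmidt.mulLeft (backwardShift H)) ∧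
      Function.Surjective
        (HilbertSchmidt.mulRight (ContinuousLinearMap.adjoint (backwardShift H))) ∧
      ¬ FiniteDimensional ℂ
        ↥((HilbertSchmidt.mulLeft (backwardShift H)).ker ⊓
          (HilbertSchmidt.mulRight (ContinuousLinearMap.adjoint (backwardShift H))).ker) ∧
      (HilbertSchmidt.mulLeft (backwardShift H) ∘L
          HilbertSchmidt.mulRight (ContinuousLinearMap.adjoint (backwardShift H))).ker =
        (HilbertSchmidt.mulLeft (backwardShift H)).ker ⊔
          (HilbertSchmidt.mulRight (ContinuousLinearMap.adjoint (backwardShift H))).ker) := by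
  have hL : mulLeft (backwardShift H) * mulLeft (adjoint (backwardShift H)) = 1 :=
    mulLeft_mul_mulLeft backwardShift_mul_adjoint
  have hR : mulRight (adjoint (backwardShift H)) * mulRight (backwardShift H) = 1 :=
    mulRight_mul_mulRight backwardShift_mul_adjoint
  have hcomm := commute_mulLeft_mulRight (backwardShift H) (adjoint (backwardShift H))
  have hnt : Nontrivial H := by
    by_contra hn
    rw [not_nontrivial_iff_subsingleton] at hn
    exact hH inferInstance
  refine ⟨⟨backwardShift_isUniversalOperator_mulLeft, backwardShift_isUniversalOperator_mulRight,
      backwardShift_isUniversalOperator_mulLeft, backwardShift_isUniversalOperator_mulRight⟩,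
    ⟨commute_mulLeft_mulRight _ _, finrank_ker_inf_ker_backwardShift, fun h => ?_⟩,
    backwardShift_isUniversalCommutingPair hH, surjective_of_mul_eq_one hL,
    surjective_of_mul_eq_one hR, not_finiteDimensional_ker_inf_ker hH,
    ker_comp_eq_sup_of_rightInverse hcomm hL (commute_mulLeft_mulRight _ _).symm⟩
  have := Module.finite_of_finrank_eq_succ finrank_ker_inf_ker_backwardShift
  exact HilbertSchmidt.not_finiteDimensional lp.not_finiteDimensional_nat h.finiteDimensional
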